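/- **Theorem.** Let $Q$ be a finite quiver with vertex set $I$ and head and tail maps $h,t$ from its arrows to $I$. Let $\overline Q$ be its double, obtained by adding, for each arrow $a$ of $Q$, an arrow $a^*$ with the same endpoints and opposite direction. The path algebra $\mathbb C\overline Q$ (paths written from right to left) is graded by the number of dual arrows $a^*$, and $\mathcal VQ=\bigoplus_r\mathcal V^rQ$ is the graded quotient vector space of $\mathbb C\overline Q$ by the span of all $PR-(-1)^{pr}RP$ with $P\in\mathbb C\overline Q^{\,p}$, $R\in\mathbb C\overline Q^{\,r}$. For an arrow $w$ of $\overline Q$ let $D_w:\mathcal VQ\to\mathbb C\overline Q$ be the linear map which sends a closed path $x_1\cdots x_n$ to $\sum_{x_i=w}(-1)^{\lambda_i\mu_i}x_{i+1}\cdots x_nx_1\cdots x_{i-1}$, where $\lambda_i$ and $\mu_i$ are the numbers of dual arrows among $x_{i+1},\dots,x_n$ and among $x_1,\dots,x_i$, and which sends paths that are not closed to $0$. The Schouten bracket of $\gamma\in\mathcal V^rQ$ and $\delta\in\mathcal V^sQ$ is the class $$[\gamma,\delta]_{\mathcal V}=\sum_{a\in Q}\bigl(D_{a^*}(\gamma)D_a(\delta)-(-1)^{(r-1)(s-1)}D_{a^*}(\delta)D_a(\gamma)\bigr)\in\mathcal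 VQ .$$ For a dimension vector $\alpha\in\mathbb Z_{\ge0}^I$ let $\mathrm{Rep}(Q,\alpha)=\bigoplus_{a\in Q}\mathrm{Mat}_{\alpha_{h(a)}\times\alpha_{t(a)}}(\mathbb C)$. Let $\Phi$ be the map from $\mathbb C\overline Q$ to polynomial contravariant tensor fields on $\mathrm{Rep}(Q,\alpha)$ with values in $|\alpha|\times|\alpha|$ block matrices, $|\alpha|=\sum_i\alpha_i$, which is multiplicative on paths, sends the trivial path $e_i$ to the identity matrix in the block $(i,i)$, sends $a$ to the matrix $X_a$ of coordinate functions in the block $(h(a),t(a))$, and sends $a^*$ to the matrix in the block $(t(a),h(a))$ whose $(n,m)$ entry is the vector field $\partial/\partial (X_a)_{mn}$. Let $\lambda=(\lambda_i)_{i\in I}$ be complex numbers with $\lambda_{h(a)}=\lambda_{t(a)}\neq0$ for every arrow $a$ of $Q$ (for instance all $\lambda_i=1$), and let $\Psi=\Psi_\lambda$ be the map from $\mathcal V^rQ$ to polynomial $r$-vector fields on $\mathrm{Rep}(Q,\alpha)$ induced by taking the skew-symmetric part of $\sum_i\lambda_i\,\mathrm{tr}\,\Phi(\cdot)_{ii}$.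 Let $\Pi\in\mathcal V^2Q$. If, for every dimension vector $\alpha$, the bivector field $\Psi(\Pi)$ on $\mathrm{Rep}(Q,\alpha)$ is a Poisson structure, i.e. its Schouten bracket with itself vanishes, then $\Pi$ is a Poisson structure on $\mathbb CQ$, i.e. $[\Pi,\Pi]_{\mathcal V}=0$. -/

import Mathlib

open scoped TensorProduct

namespace QuiverPoisson

/-! ## The double quiver and its path algebra -/

section PathAlgebra

variable {I : Type*} [Quiver I]

/-- The arrows of the double quiver: `Sum.inl a` is the arrow `a`, `Sum.inr a` is its dual `a*`. -/
abbrev DArrow (I : Type*) [Quiver I] := Quiver.Total I ⊕ Quiver.Total I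

/-- The head of an arrow of the double quiver. -/
def DArrow.head : DArrow I → I
  | Sum.inl a => a.right
  | Sum.inr a => a.left

/-- The tail of an arrow of the double quiver. -/
def DArrow.tail : DArrow I → I
  | Sum.inl a => a.left
  | Sum.inr a => a.right

/-- The number of dual arrows in a word `x₁ … xₙ` of arrows of the double quiver. -/
def wordDeg (w : List (DArrow I)) : ℕ := w.countP (fun x => x.isRight)

/-- `IsPath j [x₁, …, xₙ] i`: the word `x₁ … xₙ`, read from right to left, is a path from `i`
to `j`. The empty word is the trivial path at `i = j`. -/
def IsPath : I → List (DArrow I) → I → Prop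
  | j, [], i => j = i
  | j, x :: w, i => x.head = j ∧ IsPath x.tail w i

/-- Paths of the double quiver, including the trivial path at each vertex. -/
@[ext]
structure DPath (I : Type*) [Quiver I] where
  /-- the end point of the path -/
  tgt : I
  /-- the word `x₁ … xₙ`, written from right to left -/
  word : List (DArrow I)
  /-- the starting point of the path -/
  src : I
  isPath : IsPath tgt word src

/-- The degree of a path: the number of its dual arrows. -/
def DPath.deg (p : DPath I) : ℕ := wordDeg p.word

/-- The underlying vector space of the path algebra over `ℂ` of the double quiver. -/
abbrev PathAlg (I : Type*) [Quiver I] := DPath I →₀ ℂ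

open Classical in
/-- The element `x₁ ⋯ xₙ` of the path algebra given by a word, as a path from `i` to `j`;
it is zero if the word is not such a path. -/
noncomputable def ofWord (j : I) (w : List (DArrow I)) (i : I) : PathAlg I :=
  if h : IsPath j w i then Finsupp.single ⟨j, w, i, h⟩ 1 else 0

open Classical in
/-- The product of two paths: their concatenation (first `q`, then `p`), or zero. -/
noncomputable def mulPath (p q : DPath I) : PathAlg I :=
  if p.src = q.tgt then ofWord p.tgt (p.word ++ q.word) q.src else 0

/-- The multiplication of the path algebra. -/
noncomputable def pmul : PathAlg I →ₗ[ℂ] PathAlg I →ₗ[ℂ] PathAlg I :=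
  Finsupp.linearCombination ℂ fun p : DPath I =>
    (Finsupp.linearCombination ℂ fun q : DPath I => mulPath p q : PathAlg I →ₗ[ℂ] PathAlg I)

/-- The part of degree `r` of the path algebra, spanned by the paths with exactly `r` dual
arrows. -/
noncomputable def pathGrade (I : Type*) [Quiver I] (r : ℕ) : Submodule ℂ (PathAlg I) :=
  Submodule.span ℂ {x | ∃ p : DPath I, p.deg = r ∧ x = Finsupp.single p 1}

/-- The linear span of the relations `P Q = (-1) ^ (p q) Q P` for `P`, `Q` homogeneous of
degrees `p`, `q`. -/
noncomputable def superComm (I : Type*) [Quiver I] : Submodule ℂ (PathAlg I) :=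
  Submodule.span ℂ {x | ∃ (p q : ℕ) (P Q : PathAlg I), P ∈ pathGrade I p ∧ Q ∈ pathGrade I q ∧
    x = pmul P Q - (-1 : ℂ) ^ (p * q) • pmul Q P}

/-- The space of necklaces `𝒱Q`. -/
abbrev Necklace (I : Type*) [Quiver I] := PathAlg I ⧸ superComm I

/-- The part `𝒱ʳQ` of degree `r` of the space of necklaces. -/
noncomputable def necklaceGrade (I : Type*) [Quiver I] (r : ℕ) : Submodule ℂ (Necklace I) :=
  (pathGrade I r).map (superComm I).mkQ

lemma isPath_append {j k i : I} {u v : List (DArrow I)} (hu : IsPath j u k) (hv : IsPath k v i) :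
    IsPath j (u ++ v) i := by
  induction u generalizing j with
  | nil => simp only [IsPath] at hu; subst hu; simpa using hv
  | cons x u ih => exact ⟨hu.1, ih hu.2⟩

lemma pmul_single (p q : DPath I) :
    pmul (Finsupp.single p 1) (Finsupp.single q 1) = mulPath p q := by
  simp [pmul]

lemma mulPath_of_eq (p q : DPath I) (h : p.src = q.tgt) :
    mulPath p q = Finsupp.single
      ⟨p.tgt, p.word ++ q.word, q.src, isPath_append p.isPath (h ▸ q.isPath)⟩ 1 := by
  rw [mulPath, if_pos h, ofWord, dif_pos]

/-- A linear map that is supercyclic on paths vanishes on the relations. -/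
lemma superComm_le_ker {N : Type*} [AddCommGroup N] [Module ℂ N] (f : PathAlg I →ₗ[ℂ] N)
    (hf : ∀ p q : DPath I, f (mulPath p q) = (-1 : ℂ) ^ (p.deg * q.deg) • f (mulPath q p)) :
    superComm I ≤ LinearMap.ker f := by
  rw [superComm, Submodule.span_le]
  rintro x ⟨p, q, P, Q, hP, hQ, rfl⟩
  rw [SetLike.mem_coe, LinearMap.mem_ker, map_sub, map_smul, sub_eq_zero]
  induction hP using Submodule.span_induction with
  | zero => simp
  | add P P' _ _ h h' => simp only [map_add, LinearMap.add_apply, h, h', smul_add]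
  | smul c P _ h => simp only [map_smul, LinearMap.smul_apply, h, smul_comm c]
  | mem P hP =>
    obtain ⟨u, rfl, rfl⟩ := hP
    induction hQ using Submodule.span_induction with
    | zero => simp
    | add P P' _ _ h h' => simp only [map_add, LinearMap.add_apply, h, h', smul_add]
    | smul c P _ h => simp only [map_smul, LinearMap.smul_apply, h, smul_comm c]
    | mem Q hQ =>
      obtain ⟨v, rfl, rfl⟩ := hQ
      rw [pmul_single, pmul_single, hf]

/-! ## The directional superderivatives and the Schouten bracket on necklaces -/

open Classical in
/-- The sum `∑_{xₖ = w} (-1) ^ (λₖ μₖ) x_{k+1} ⋯ xₙ x₁ ⋯ x_{k-1}` for a word `x₁ … xₙ`, where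
`λₖ` and `μₖ` are the numbers of dual arrows among `x_{k+1}, …, xₙ` and `x₁, …, xₖ`. The index
below starts at `0`. -/
noncomputable def wordDeriv (w : DArrow I) (l : List (DArrow I)) : PathAlg I :=
  ∑ k ∈ Finset.range l.length,
    if l[k]? = some w then
      (-1 : ℂ) ^ (wordDeg (l.drop (k + 1)) * wordDeg (l.take (k + 1))) •
        ofWord w.tail (l.drop (k + 1) ++ l.take k) w.head
    else 0

open Classical in
/-- The directional superderivative on paths; it is zero on paths that are not closed. -/
noncomputable def pathDeriv (w : DArrow I) : PathAlg I →ₗ[ℂ] PathAlg I :=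
  Finsupp.linearCombination ℂ fun p : DPath I =>
    if p.tgt = p.src then wordDeriv w p.word else 0

open Classical in
lemma wordDeriv_append (w : DArrow I) (u v : List (DArrow I)) :
    wordDeriv w (u ++ v) = (-1 : ℂ) ^ (wordDeg u * wordDeg v) • wordDeriv w (v ++ u) := by
  have key : ∀ (u v : List (DArrow I)), ∀ k ∈ Finset.range u.length,
      (if (u ++ v)[k]? = some w then
        (-1 : ℂ) ^ (wordDeg ((u ++ v).drop (k + 1)) * wordDeg ((u ++ v).take (k + 1))) •
          ofWord w.tail ((u ++ v).drop (k + 1) ++ (u ++ v).take k) w.head else 0) =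
      (-1 : ℂ) ^ (wordDeg u * wordDeg v) •
      (if (v ++ u)[v.length + k]? = some w then
        (-1 : ℂ) ^ (wordDeg ((v ++ u).drop (v.length + k + 1)) *
            wordDeg ((v ++ u).take (v.length + k + 1))) •
          ofWord w.tail ((v ++ u).drop (v.length + k + 1) ++ (v ++ u).take (v.length + k)) w.head
        else 0) := by
    intro u v k hk
    rw [Finset.mem_range] at hk
    have e1 : (u ++ v)[k]? = u[k]? := List.getElem?_append_left hk
    have e2 : (v ++ u)[v.length + k]? = u[k]? := by
      rw [List.getElem?_append_right (by omega)]; congr 1; omega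
    have e3 : (u ++ v).drop (k + 1) = u.drop (k + 1) ++ v := List.drop_append_of_le_length hk
    have e4 : ∀ m, m ≤ u.length → (u ++ v).take m = u.take m :=
      fun m hm => List.take_append_of_le_length hm
    have e5 : (v ++ u).drop (v.length + k + 1) = u.drop (k + 1) := by
      rw [add_assoc, List.drop_append, List.drop_eq_nil_of_le (by omega)]; simp
    have e6 : ∀ m, (v ++ u).take (v.length + m) = v ++ u.take m := by
      intro m; rw [List.take_append, List.take_of_length_le (by omega)]; simp
    rw [e1, e2, e3, e4 _ hk, e4 _ hk.le, e5, add_assoc, e6, e6]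
    split_ifs with h
    · rw [smul_smul, ← pow_add, List.append_assoc]
      congr 1
      have hu : wordDeg u = wordDeg (u.take (k + 1)) + wordDeg (u.drop (k + 1)) := by
        simp only [wordDeg, ← List.countP_append, List.take_append_drop]
      rw [hu]
      simp only [wordDeg, List.countP_append]
      generalize List.countP _ (u.drop (k + 1)) = a
      generalize List.countP _ (u.take (k + 1)) = b
      generalize List.countP _ v = c
      have : (b + a) * c + a * (c + b) = (a + c) * b + 2 * (a * c) := by ring
      rw [this, pow_add, pow_mul]
      simp
    · simp
  unfold wordDeriv
  rw [List.length_append, Finset.sum_range_add, List.length_append, Finset.sum_range_add,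
    add_comm, smul_add]
  congr 1
  · rw [Finset.smul_sum]
    refine Finset.sum_congr rfl fun k hk => ?_
    rw [key v u k hk, smul_smul, ← pow_add, mul_comm (wordDeg v), ← two_mul, pow_mul]
    simp
  · rw [Finset.smul_sum]
    exact Finset.sum_congr rfl (key u v)

lemma pathDeriv_mulPath (w : DArrow I) (p q : DPath I) :
    pathDeriv w (mulPath p q) = (-1 : ℂ) ^ (p.deg * q.deg) • pathDeriv w (mulPath q p) := by
  by_cases h : p.src = q.tgt <;> by_cases h' : q.src = p.tgt
  · rw [mulPath_of_eq p q h, mulPath_of_eq q p h']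
    simp only [pathDeriv, Finsupp.linearCombination_single, one_smul, h, h', if_true]
    exact wordDeriv_append w _ _
  · rw [mulPath_of_eq p q h, mulPath, if_neg h']
    simp [pathDeriv, Ne.symm h']
  · rw [mulPath_of_eq q p h', mulPath, if_neg h]
    simp [pathDeriv, Ne.symm h]
  · rw [mulPath, mulPath, if_neg h, if_neg h']
    simp

/-- The directional superderivative `D_w : 𝒱Q → ℂQ̄`. -/
noncomputable def superDeriv (w : DArrow I) : Necklace I →ₗ[ℂ] PathAlg I :=
  (superComm I).liftQ (pathDeriv w) (superComm_le_ker _ (pathDeriv_mulPath w))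

/-- The Schouten bracket of `γ ∈ 𝒱ʳQ` and `δ ∈ 𝒱ˢQ`. The sign is `(-1) ^ ((r - 1) (s - 1))`. -/
noncomputable def schouten [Fintype (Quiver.Total I)] {r s : ℕ}
    (γ : necklaceGrade I r) (δ : necklaceGrade I s) : Necklace I :=
  (superComm I).mkQ (∑ a : Quiver.Total I,
    (pmul (superDeriv (Sum.inr a) (γ : Necklace I)) (superDeriv (Sum.inl a) (δ : Necklace I)) -
      (-1 : ℂ) ^ ((r + 1) * (s + 1)) •
        pmul (superDeriv (Sum.inr a) (δ : Necklace I)) (superDeriv (Sum.inl a) (γ : Necklace I))))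

/-- A Poisson structure on the path algebra `ℂQ`. -/
def IsPoisson [Fintype (Quiver.Total I)] (P : necklaceGrade I 2) : Prop :=
  schouten P P = 0

end PathAlgebra

/-! ## Polynomial tensor and polyvector fields on an affine space with coordinates `σ` -/

section AffineSpace

variable {σ : Type*}

/-- Polynomial contravariant tensor fields on `ℂ^σ`: polynomial functions with values in the
tensor algebra of the space of constant vector fields, which has the basis `∂/∂x_l`, `l : σ`. -/
abbrev TensorField (σ : Type*) := MvPolynomial σ ℂ ⊗[ℂ] TensorAlgebra ℂ (σ →₀ ℂ)

/-- Polynomial polyvector fields on `ℂ^σ`. -/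
abbrev PolyvectorField (σ : Type*) := MvPolynomial σ ℂ ⊗[ℂ] ExteriorAlgebra ℂ (σ →₀ ℂ)

/-- The skew-symmetric part of a tensor field, `∂₁ ⊗ ⋯ ⊗ ∂ᵣ ↦ ∂₁ ∧ ⋯ ∧ ∂ᵣ`. -/
noncomputable def skew (σ : Type*) : TensorField σ →ₐ[ℂ] PolyvectorField σ :=
  Algebra.TensorProduct.map (AlgHom.id ℂ _) TensorAlgebra.toExterior

/-- The coordinate function `x_l`, as a tensor field of degree `0`. -/
noncomputable def coordFun (l : σ) : TensorField σ := MvPolynomial.X l ⊗ₜ[ℂ] 1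

/-- The constant vector field `∂/∂x_l`, as a tensor field of degree `1`. -/
noncomputable def coordVec (l : σ) : TensorField σ :=
  1 ⊗ₜ[ℂ] TensorAlgebra.ι ℂ (Finsupp.single l 1)

/-- The polyvector fields of degree `r`. -/
noncomputable def polyGrade (σ : Type*) (r : ℕ) : Submodule ℂ (PolyvectorField σ) :=
  Submodule.span ℂ {x | ∃ (f : MvPolynomial σ ℂ) (u : ExteriorAlgebra ℂ (σ →₀ ℂ)),
    u ∈ ⋀[ℂ]^r (σ →₀ ℂ) ∧ x = f ⊗ₜ[ℂ] u}

/-- The partial derivative `∂/∂x_l` of the coefficients of a polyvector field. -/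
noncomputable def coeffDeriv (l : σ) : PolyvectorField σ →ₗ[ℂ] PolyvectorField σ :=
  LinearMap.rTensor _ (MvPolynomial.pderiv l : Derivation ℂ _ _).toLinearMap

/-- The contraction of a polyvector field with `dx_l` from the right, so that
`X₁ ∧ ⋯ ∧ X_r` goes to `∑ i, (-1) ^ (r - i) dx_l(X_i) X₁ ∧ ⋯ X̂_i ⋯ ∧ X_r`. -/
noncomputable def contract (l : σ) : PolyvectorField σ →ₗ[ℂ] PolyvectorField σ :=
  LinearMap.lTensor _ (CliffordAlgebra.contractRight.flip (Finsupp.lapply l))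

/-- The Schouten bracket of polyvector fields of degrees `r` and `s`. It is the bilinear operation
given by `[X₁ ⋯ X_r, Y₁ ⋯ Y_s] = ∑ i j, (-1) ^ (i + j) [X_i, Y_j] X₁ ⋯ X̂_i ⋯ X_r Y₁ ⋯ Ŷ_j ⋯ Y_s` for
vector fields `X_i`, `Y_j`, written out in coordinates.
The sign below is `(-1) ^ ((r - 1) (s - 1))`. -/
noncomputable def polySchouten [Fintype σ] {r s : ℕ} (P : polyGrade σ r) (R : polyGrade σ s) :
    PolyvectorField σ :=
  ∑ l : σ, (contract l (P : PolyvectorField σ) * coeffDeriv l (R : PolyvectorField σ) -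
    (-1 : ℂ) ^ ((r + 1) * (s + 1)) •
      (contract l (R : PolyvectorField σ) * coeffDeriv l (P : PolyvectorField σ)))

/-- A (polynomial) Poisson structure on `ℂ^σ`: a bivector field with `[π, π] = 0`. -/
def IsPoissonField [Fintype σ] (π : polyGrade σ 2) : Prop := polySchouten π π = 0

lemma polyGrade_mul {r s : ℕ} {x y : PolyvectorField σ} (hx : x ∈ polyGrade σ r)
    (hy : y ∈ polyGrade σ s) : x * y ∈ polyGrade σ (r + s) := by
  induction hx using Submodule.span_induction with
  | zero => simp
  | add x x' _ _ h h' => rw [add_mul]; exact add_mem h h'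
  | smul c x _ h => rw [smul_mul_assoc]; exact Submodule.smul_mem _ _ h
  | mem x hx =>
    obtain ⟨f, u, hu, rfl⟩ := hx
    induction hy using Submodule.span_induction with
    | zero => simp
    | add x x' _ _ h h' => rw [mul_add]; exact add_mem h h'
    | smul c x _ h => rw [mul_smul_comm]; exact Submodule.smul_mem _ _ h
    | mem y hy =>
      obtain ⟨g, v, hv, rfl⟩ := hy
      refine Submodule.subset_span ⟨f * g, u * v, ?_, by simp⟩
      rw [ExteriorAlgebra.exteriorPower, pow_add]
      exact Submodule.mul_mem_mul hu hv

lemma one_mem_polyGrade : (1 : PolyvectorField σ) ∈ polyGrade σ 0 := by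
  refine Submodule.subset_span ⟨1, 1, ?_, rfl⟩
  rw [ExteriorAlgebra.exteriorPower, pow_zero]
  exact Submodule.one_le.mp le_rfl

lemma ext_ι_comm {s : ℕ} (m : σ →₀ ℂ) {v : ExteriorAlgebra ℂ (σ →₀ ℂ)}
    (hv : v ∈ ⋀[ℂ]^s (σ →₀ ℂ)) :
    ExteriorAlgebra.ι ℂ m * v = (-1 : ℂ) ^ s • (v * ExteriorAlgebra.ι ℂ m) := by
  induction s generalizing v with
  | zero =>
    rw [ExteriorAlgebra.exteriorPower, pow_zero, Submodule.mem_one] at hv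
    obtain ⟨c, rfl⟩ := hv
    simp [Algebra.commutes]
  | succ s ih =>
    rw [ExteriorAlgebra.exteriorPower, pow_succ] at hv
    induction hv using Submodule.mul_induction_on' with
    | add x _ y _ hx hy => rw [mul_add, add_mul, smul_add, hx, hy]
    | mem_mul_mem x hx y hy =>
      obtain ⟨n, rfl⟩ := hy
      rw [← mul_assoc, ih hx, smul_mul_assoc, mul_assoc,
        eq_neg_of_add_eq_zero_left (ExteriorAlgebra.ι_add_mul_swap m n)]
      simp [pow_succ, mul_assoc]

lemma ext_comm {r s : ℕ} {u v : ExteriorAlgebra ℂ (σ →₀ ℂ)}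
    (hu : u ∈ ⋀[ℂ]^r (σ →₀ ℂ)) (hv : v ∈ ⋀[ℂ]^s (σ →₀ ℂ)) :
    u * v = (-1 : ℂ) ^ (r * s) • (v * u) := by
  induction r generalizing u with
  | zero =>
    rw [ExteriorAlgebra.exteriorPower, pow_zero, Submodule.mem_one] at hu
    obtain ⟨c, rfl⟩ := hu
    simp [Algebra.commutes]
  | succ r ih =>
    rw [ExteriorAlgebra.exteriorPower, pow_succ] at hu
    induction hu using Submodule.mul_induction_on' with
    | add x _ y _ hx hy => rw [mul_add, add_mul, smul_add, hx, hy]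
    | mem_mul_mem x hx y hy =>
      obtain ⟨n, rfl⟩ := hy
      rw [mul_assoc, ext_ι_comm n hv, mul_smul_comm, ← mul_assoc, ih hx, smul_mul_assoc,
        smul_smul, ← pow_add, mul_assoc]
      congr 2
      ring

lemma polyGrade_comm {r s : ℕ} {x y : PolyvectorField σ} (hx : x ∈ polyGrade σ r)
    (hy : y ∈ polyGrade σ s) : x * y = (-1 : ℂ) ^ (r * s) • (y * x) := by
  induction hx using Submodule.span_induction with
  | zero => simp
  | add x x' _ _ h h' => rw [add_mul, mul_add, h, h', smul_add]
  | smul c x _ h => rw [smul_mul_assoc, mul_smul_comm, h, smul_comm]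
  | mem x hx =>
    obtain ⟨f, u, hu, rfl⟩ := hx
    induction hy using Submodule.span_induction with
    | zero => simp
    | add x x' _ _ h h' => rw [mul_add, add_mul, h, h', smul_add]
    | smul c x _ h => rw [smul_mul_assoc, mul_smul_comm, h, smul_comm]
    | mem y hy =>
      obtain ⟨g, v, hv, rfl⟩ := hy
      rw [Algebra.TensorProduct.tmul_mul_tmul, Algebra.TensorProduct.tmul_mul_tmul,
        ext_comm hu hv, mul_comm f g, TensorProduct.tmul_smul]

end AffineSpace

/-! ## Representation spaces and the map `Ψ` -/

section Representations

variable {I : Type*} [Quiver I] [Fintype I]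

set_option linter.unusedSectionVars false

/-- The coordinates `(X_a)_{mn}` of the representation space
`Rep(Q, α) = ⨁_a Mat_{α(h a) × α(t a)}(ℂ)`. -/
abbrev RepCoord (α : I → ℕ) := Σ a : Quiver.Total I, Fin (α a.right) × Fin (α a.left)

/-- The row and column index of the `|α| × |α|` block matrices. -/
abbrev BlockIdx (α : I → ℕ) := Σ i : I, Fin (α i)

/-- `|α| × |α|` matrices of polynomial tensor fields on `Rep(Q, α)`, that is, matrix-valued tensor
fields. -/
abbrev MatTensorField (α : I → ℕ) :=
  Matrix (BlockIdx α) (BlockIdx α) (TensorField (RepCoord α))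

open Classical in
/-- The value of `Φ` on an arrow of the double quiver. The arrow `a` goes to the matrix of
coordinate functions `X_a`, put in the block `(h a, t a)`; the dual arrow `a*` goes to the
matrix-valued vector field whose value on a covector `Y` is `Y_a`, put in the block `(t a, h a)`:
its `(n, m)` entry is `∂/∂(X_a)_{mn}`. -/
noncomputable def tilde (α : I → ℕ) : DArrow I → MatTensorField α
  | Sum.inl a => ∑ m : Fin (α a.right), ∑ n : Fin (α a.left),
      Matrix.single (⟨a.right, m⟩ : BlockIdx α) (⟨a.left, n⟩ : BlockIdx α)
        (coordFun (⟨a, m, n⟩ : RepCoord α))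
  | Sum.inr a => ∑ m : Fin (α a.right), ∑ n : Fin (α a.left),
      Matrix.single (⟨a.left, n⟩ : BlockIdx α) (⟨a.right, m⟩ : BlockIdx α)
        (coordVec (⟨a, m, n⟩ : RepCoord α))

open Classical in
/-- The value of `Φ` on the trivial path `e_i`: the identity matrix in the block `(i, i)`. -/
noncomputable def blockId (α : I → ℕ) (i : I) : MatTensorField α :=
  Matrix.diagonal fun x => if x.1 = i then 1 else 0

open Classical in
/-- The matrix `e_j x̃₁ ⋯ x̃ₙ` for a word `x₁ … xₙ` ending at `j`. -/
noncomputable def evalWord (α : I → ℕ) (j : I) (w : List (DArrow I)) : MatTensorField α :=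
  blockId α j * (w.map (tilde α)).prod

/-- The map `Φ` from the path algebra of the double quiver to matrix-valued tensor fields on
`Rep(Q, α)`. -/
noncomputable def Phi (α : I → ℕ) : PathAlg I →ₗ[ℂ] MatTensorField α :=
  Finsupp.linearCombination ℂ fun p : DPath I => evalWord α p.tgt p.word

/-- The trace `tr_λ Z = ∑ i, λ_i tr Z_{ii}`. -/
noncomputable def traceLam (lam : I → ℂ) (α : I → ℕ) :
    MatTensorField α →ₗ[ℂ] TensorField (RepCoord α) :=
  ∑ x : BlockIdx α, lam x.1 • Matrix.entryLinearMap ℂ (TensorField (RepCoord α)) x x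

/-- The map `Ψ_λ` on the path algebra: the skew-symmetric part of `tr_λ ∘ Φ`. -/
noncomputable def PsiPath (lam : I → ℂ) (α : I → ℕ) :
    PathAlg I →ₗ[ℂ] PolyvectorField (RepCoord α) :=
  (skew (RepCoord α)).toLinearMap ∘ₗ traceLam lam α ∘ₗ Phi α

/-! The map `Ψ_λ` descends to necklaces and preserves degrees. -/

lemma tilde_lam (lam : I → ℂ) (hlam : ∀ a : Quiver.Total I, lam a.right = lam a.left)
    (α : I → ℕ) (d : DArrow I) (x y : BlockIdx α) :
    lam x.1 • tilde α d x y = lam y.1 • tilde α d x y := by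
  classical
  rcases d with a | a <;>
  · simp only [tilde, Matrix.sum_apply, Finset.smul_sum]
    refine Finset.sum_congr rfl fun m _ => Finset.sum_congr rfl fun n _ => ?_
    rw [Matrix.single_apply]
    split_ifs with h
    · obtain ⟨rfl, rfl⟩ := h
      simp [hlam]
    · simp

lemma blockId_mul_tilde (α : I → ℕ) (d : DArrow I) : blockId α d.head * tilde α d = tilde α d := by
  classical
  ext x y
  rw [blockId, Matrix.diagonal_mul]
  split_ifs with h
  · simp
  · rw [zero_mul]
    rcases d with a | a <;>
    · simp only [tilde, Matrix.sum_apply]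
      symm
      refine Finset.sum_eq_zero fun m _ => Finset.sum_eq_zero fun n _ => ?_
      rw [Matrix.single_apply, if_neg]
      rintro ⟨rfl, rfl⟩
      exact h rfl

lemma tilde_mul_blockId (α : I → ℕ) (d : DArrow I) : tilde α d * blockId α d.tail = tilde α d := by
  classical
  ext x y
  rw [blockId, Matrix.mul_diagonal]
  split_ifs with h
  · simp
  · rw [mul_zero]
    rcases d with a | a <;>
    · simp only [tilde, Matrix.sum_apply]
      symm
      refine Finset.sum_eq_zero fun m _ => Finset.sum_eq_zero fun n _ => ?_
      rw [Matrix.single_apply, if_neg]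
      rintro ⟨rfl, rfl⟩
      exact h rfl

lemma evalWord_cons (α : I → ℕ) (d : DArrow I) (w : List (DArrow I)) :
    evalWord α d.head (d :: w) = tilde α d * evalWord α d.tail w := by
  classical
  simp only [evalWord, List.map_cons, List.prod_cons]
  rw [← mul_assoc, blockId_mul_tilde, ← mul_assoc, tilde_mul_blockId]

lemma evalWord_append (α : I → ℕ) {j k : I} {u : List (DArrow I)} (hu : IsPath j u k)
    (v : List (DArrow I)) : evalWord α j (u ++ v) = evalWord α j u * evalWord α k v := by
  classical
  induction u generalizing j with
  | nil =>
    simp only [IsPath] at hu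
    subst hu
    have : blockId α j * blockId α j = blockId α j := by
      rw [blockId, Matrix.diagonal_mul_diagonal]
      congr 1
      ext x
      simp
    simp only [evalWord, List.nil_append, List.map_nil, List.prod_nil, mul_one]
    rw [← mul_assoc, this]
  | cons d u ih =>
    obtain ⟨rfl, hu⟩ := hu
    rw [List.cons_append, evalWord_cons, evalWord_cons, ih hu, mul_assoc]

lemma evalWord_mul_blockId (α : I → ℕ) {j k : I} {u : List (DArrow I)} (hu : IsPath j u k) :
    evalWord α j u * blockId α k = evalWord α j u := by
  have := evalWord_append α hu []
  simpa [evalWord] using this.symm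

lemma evalWord_apply_left (α : I → ℕ) (j : I) (u : List (DArrow I)) (x y : BlockIdx α)
    (h : x.1 ≠ j) : evalWord α j u x y = 0 := by
  classical
  rw [evalWord, blockId, Matrix.diagonal_mul, if_neg h, zero_mul]

lemma evalWord_apply_right (α : I → ℕ) {j k : I} {u : List (DArrow I)} (hu : IsPath j u k)
    (x y : BlockIdx α) (h : y.1 ≠ k) : evalWord α j u x y = 0 := by
  classical
  rw [← evalWord_mul_blockId α hu, blockId, Matrix.mul_diagonal, if_neg h, mul_zero]

lemma evalWord_lam (lam : I → ℂ) (hlam : ∀ a : Quiver.Total I, lam a.right = lam a.left)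
    (α : I → ℕ) {j k : I} {u : List (DArrow I)} (hu : IsPath j u k) (x y : BlockIdx α) :
    lam x.1 • evalWord α j u x y = lam y.1 • evalWord α j u x y := by
  classical
  induction u generalizing j x with
  | nil =>
    by_cases h : x = y
    · rw [h]
    · simp [evalWord, blockId, h]
  | cons d u ih =>
    obtain ⟨rfl, hu⟩ := hu
    rw [evalWord_cons, Matrix.mul_apply, Finset.smul_sum, Finset.smul_sum]
    refine Finset.sum_congr rfl fun z _ => ?_
    rw [← smul_mul_assoc, tilde_lam lam hlam, smul_mul_assoc, ← mul_smul_comm, ih hu,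
      mul_smul_comm]

lemma skew_coordFun {σ : Type*} (l : σ) : skew σ (coordFun l) ∈ polyGrade σ 0 := by
  refine Submodule.subset_span ⟨MvPolynomial.X l, 1, ?_, by simp [skew, coordFun]⟩
  rw [ExteriorAlgebra.exteriorPower, pow_zero]
  exact Submodule.one_le.mp le_rfl

lemma skew_coordVec {σ : Type*} (l : σ) : skew σ (coordVec l) ∈ polyGrade σ 1 := by
  refine Submodule.subset_span
    ⟨1, ExteriorAlgebra.ι ℂ (Finsupp.single l 1), ?_, by simp [skew, coordVec]⟩
  rw [ExteriorAlgebra.exteriorPower, pow_one]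
  exact LinearMap.mem_range_self _ _

lemma skew_tilde (α : I → ℕ) (d : DArrow I) (x y : BlockIdx α) :
    skew _ (tilde α d x y) ∈ polyGrade (RepCoord α) (wordDeg [d]) := by
  classical
  rcases d with a | a <;>
  · simp only [tilde, Matrix.sum_apply, map_sum]
    refine Submodule.sum_mem _ fun m _ => Submodule.sum_mem _ fun n _ => ?_
    rw [Matrix.single_apply]
    split_ifs
    · first | exact skew_coordFun _ | exact skew_coordVec _
    · simp

lemma skew_evalWord (α : I → ℕ) {j k : I} {u : List (DArrow I)} (hu : IsPath j u k)
    (x y : BlockIdx α) :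
    skew _ (evalWord α j u x y) ∈ polyGrade (RepCoord α) (wordDeg u) := by
  classical
  induction u generalizing j x with
  | nil =>
    simp only [evalWord, List.map_nil, List.prod_nil, mul_one, blockId, Matrix.diagonal_apply]
    split_ifs
    · rw [map_one]; exact one_mem_polyGrade
    · simp
    · simp
  | cons d u ih =>
    obtain ⟨rfl, hu⟩ := hu
    rw [evalWord_cons, Matrix.mul_apply, map_sum]
    refine Submodule.sum_mem _ fun z _ => ?_
    rw [map_mul]
    have : wordDeg (d :: u) = wordDeg [d] + wordDeg u := by
      simp only [wordDeg, ← List.countP_append, List.singleton_append]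
    rw [this]
    exact polyGrade_mul (skew_tilde α d x z) (ih hu z)

lemma PsiPath_single (lam : I → ℂ) (α : I → ℕ) (p : DPath I) :
    PsiPath lam α (Finsupp.single p 1) =
      ∑ x : BlockIdx α, lam x.1 • skew _ (evalWord α p.tgt p.word x x) := by
  simp [PsiPath, Phi, traceLam]

lemma PsiPath_of_ne (lam : I → ℂ) (α : I → ℕ) (p : DPath I) (h : p.tgt ≠ p.src) :
    PsiPath lam α (Finsupp.single p 1) = 0 := by
  rw [PsiPath_single]
  refine Finset.sum_eq_zero fun x _ => ?_
  by_cases hx : x.1 = p.tgt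
  · rw [evalWord_apply_right α p.isPath x x (hx ▸ h)]; simp
  · rw [evalWord_apply_left α p.tgt p.word x x hx]; simp

lemma PsiPath_mulPath (lam : I → ℂ) (hlam : ∀ a : Quiver.Total I, lam a.right = lam a.left)
    (α : I → ℕ) (p q : DPath I) :
    PsiPath lam α (mulPath p q) = (-1 : ℂ) ^ (p.deg * q.deg) • PsiPath lam α (mulPath q p) := by
  classical
  by_cases h : p.src = q.tgt <;> by_cases h' : q.src = p.tgt
  · rw [mulPath_of_eq p q h, mulPath_of_eq q p h', PsiPath_single, PsiPath_single]
    have hp : ∀ x y : BlockIdx α, lam x.1 • skew _ (evalWord α p.tgt p.word x y) =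
        lam y.1 • skew _ (evalWord α p.tgt p.word x y) := by
      intro x y
      rw [← map_smul, evalWord_lam lam hlam α p.isPath, map_smul]
    simp only [evalWord_append α p.isPath, evalWord_append α q.isPath, h, h', Matrix.mul_apply,
      map_sum, map_mul, Finset.smul_sum]
    rw [Finset.sum_comm]
    refine Finset.sum_congr rfl fun y _ => Finset.sum_congr rfl fun x _ => ?_
    rw [← smul_mul_assoc, hp, smul_mul_assoc,
      polyGrade_comm (skew_evalWord α p.isPath x y) (skew_evalWord α q.isPath y x), smul_comm]
    rfl
  · rw [mulPath_of_eq p q h, PsiPath_of_ne _ _ _ (Ne.symm h'), mulPath, if_neg h']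
    simp
  · rw [mulPath_of_eq q p h', PsiPath_of_ne _ _ _ (Ne.symm h), mulPath, if_neg h]
    simp
  · rw [mulPath, mulPath, if_neg h, if_neg h']
    simp

/-- The map `Ψ_λ : 𝒱Q → 𝒱(Rep(Q, α))`. It is well defined when `λ` takes the same value at the two
ends of each arrow. -/
noncomputable def PsiNecklace (lam : I → ℂ)
    (hlam : ∀ a : Quiver.Total I, lam a.right = lam a.left) (α : I → ℕ) :
    Necklace I →ₗ[ℂ] PolyvectorField (RepCoord α) :=
  (superComm I).liftQ (PsiPath lam α) (superComm_le_ker _ (PsiPath_mulPath lam hlam α))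

lemma PsiNecklace_mem (lam : I → ℂ) (hlam : ∀ a : Quiver.Total I, lam a.right = lam a.left)
    (α : I → ℕ) {r : ℕ} {γ : Necklace I} (hγ : γ ∈ necklaceGrade I r) :
    PsiNecklace lam hlam α γ ∈ polyGrade (RepCoord α) r := by
  obtain ⟨P, hP, rfl⟩ := hγ
  change PsiPath lam α P ∈ _
  induction hP using Submodule.span_induction with
  | zero => simp
  | add x y _ _ hx hy => rw [map_add]; exact add_mem hx hy
  | smul c x _ hx => rw [map_smul]; exact Submodule.smul_mem _ _ hx
  | mem x hx =>
    obtain ⟨p, rfl, rfl⟩ := hx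
    rw [PsiPath_single]
    exact Submodule.sum_mem _ fun x _ => Submodule.smul_mem _ _ (skew_evalWord α p.isPath x x)

/-- The map `Ψ_λ : 𝒱ʳQ → 𝒱ʳ(Rep(Q, α))` in degree `r`. -/
noncomputable def Psi (lam : I → ℂ) (hlam : ∀ a : Quiver.Total I, lam a.right = lam a.left)
    (α : I → ℕ) {r : ℕ} (γ : necklaceGrade I r) : polyGrade (RepCoord α) r :=
  ⟨PsiNecklace lam hlam α γ, PsiNecklace_mem lam hlam α γ.2⟩

end Representations

end QuiverPoisson

namespace QuiverPoisson

/-! ### Leibniz rules for polyvector fields on affine space -/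

section Derivations

variable {σ : Type*}

/-! The maps `Ψ` turn the necklace bracket into the Schouten bracket of polyvector fields, and
jointly they lose nothing but trivial paths.

Compatibility. Differentiating the trace of a product of matrices in one coordinate, or contracting
it with one covector, cuts the cyclic word open at each occurrence of the corresponding arrow `w`.
What remains is an entry of the skew part of `Φ (D_w Z)`, scaled by the weight at the head of `w`
(`fieldDeriv_PsiPath`). Summing over the entries of `X_a` reassembles a matrix product. The two
derivatives contribute one weight each, so the bracket of two images under `Ψ_λ` is the image of the
necklace bracket under `Ψ` with weights `λ ^ 2` (`polySchouten_Psi`).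

Injectivity. If the images of `Z` vanish for all `α`, so do their derivatives and contractions,
hence the skew part of `Φ (D_w Z)`, the weights at arrow ends being nonzero. Large matrices with
suitably specialized entries separate all paths, even after skew-symmetrization
(`eq_zero_of_skewPhi_eq_zero`), so `D_w Z = 0`. An Euler formula (`sum_appendArrow_superDeriv`)
recovers the class of `Z` from all `D_w Z` if `Z` has no trivial paths. The bracket of `Π` with
itself has none, because a superderivative of a degree 2 element still contains an arrow in each of
its paths. -/

lemma coeffDeriv_tmul (l : σ) (f : MvPolynomial σ ℂ) (u : ExteriorAlgebra ℂ (σ →₀ ℂ)) :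
    coeffDeriv l (f ⊗ₜ[ℂ] u) = MvPolynomial.pderiv l f ⊗ₜ[ℂ] u := rfl

lemma contract_tmul (l : σ) (f : MvPolynomial σ ℂ) (u : ExteriorAlgebra ℂ (σ →₀ ℂ)) :
    contract l (f ⊗ₜ[ℂ] u) =
      f ⊗ₜ[ℂ] (CliffordAlgebra.contractRight u (Finsupp.lapply l)) := rfl

lemma coeffDeriv_mul (l : σ) (x y : PolyvectorField σ) :
    coeffDeriv l (x * y) = x * coeffDeriv l y + coeffDeriv l x * y := by
  induction x using TensorProduct.induction_on with
  | zero => simp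
  | add x x' h h' => simp only [add_mul, map_add, h, h']; abel
  | tmul f u =>
    induction y using TensorProduct.induction_on with
    | zero => simp
    | add y y' h h' => simp only [mul_add, map_add, h, h']; abel
    | tmul g v =>
      simp only [Algebra.TensorProduct.tmul_mul_tmul, coeffDeriv_tmul, Derivation.leibniz,
        TensorProduct.add_tmul, smul_eq_mul, mul_comm g]

/-- A contraction acting from the right must pass `v` to reach `u`, at the cost of one sign per
vector of `v`. The induction peels vectors off the right end of `v`, so `u` need not be homogeneous.
-/
lemma contractRight_mul (d : Module.Dual ℂ (σ →₀ ℂ)) (u : ExteriorAlgebra ℂ (σ →₀ ℂ)) {s : ℕ}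
    {v : ExteriorAlgebra ℂ (σ →₀ ℂ)} (hv : v ∈ ⋀[ℂ]^s (σ →₀ ℂ)) :
    CliffordAlgebra.contractRight (u * v) d =
      u * CliffordAlgebra.contractRight v d +
        (-1 : ℂ) ^ s • (CliffordAlgebra.contractRight u d * v) := by
  induction s generalizing v with
  | zero =>
    rw [ExteriorAlgebra.exteriorPower, pow_zero, Submodule.mem_one] at hv
    obtain ⟨c, rfl⟩ := hv
    rw [CliffordAlgebra.contractRight_mul_algebraMap, CliffordAlgebra.contractRight_algebraMap]
    simp
  | succ s ih =>
    rw [ExteriorAlgebra.exteriorPower, pow_succ] at hv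
    induction hv using Submodule.mul_induction_on' with
    | add x _ y _ hx hy =>
      simp only [mul_add, map_add, LinearMap.add_apply, hx, hy, smul_add]; abel
    | mem_mul_mem x hx y hy =>
      obtain ⟨n, rfl⟩ := hy
      rw [← mul_assoc, ExteriorAlgebra.ι, CliffordAlgebra.contractRight_mul_ι, ih hx,
        CliffordAlgebra.contractRight_mul_ι, mul_sub, add_mul, mul_smul_comm, smul_mul_assoc,
        pow_succ, mul_smul, neg_one_smul, smul_neg, mul_assoc, mul_assoc]
      abel

lemma contract_mul (l : σ) (x : PolyvectorField σ) {s : ℕ} {y : PolyvectorField σ}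
    (hy : y ∈ polyGrade σ s) :
    contract l (x * y) = x * contract l y + (-1 : ℂ) ^ s • (contract l x * y) := by
  induction hy using Submodule.span_induction with
  | zero => simp
  | add y y' _ _ h h' => simp only [mul_add, map_add, h, h', smul_add]; abel
  | smul c y _ h => simp only [mul_smul_comm, map_smul, h, smul_add, smul_comm c]
  | mem y hy =>
    obtain ⟨g, v, hv, rfl⟩ := hy
    induction x using TensorProduct.induction_on with
    | zero => simp
    | add x x' h h' => simp only [add_mul, map_add, h, h', smul_add]; abel
    | tmul f u =>
      simp only [Algebra.TensorProduct.tmul_mul_tmul, contract_tmul, contractRight_mul _ u hv,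
        TensorProduct.tmul_add, TensorProduct.tmul_smul]

end Derivations

/-! ### Cutting words, and multiplicativity of the skew part of `Φ` -/

section Words

variable {I : Type*} [Quiver I]

lemma IsPath.split {j i : I} {l : List (DArrow I)} (h : IsPath j l i) {w : DArrow I} {k : ℕ}
    (hk : l[k]? = some w) :
    IsPath j (l.take k) w.head ∧ IsPath w.tail (l.drop (k + 1)) i := by
  induction l generalizing j k with
  | nil => simp at hk
  | cons d l ih =>
    obtain ⟨hd, hl⟩ := h
    cases k with
    | zero =>
      simp only [List.getElem?_cons_zero, Option.some.injEq] at hk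
      subst hk
      exact ⟨hd.symm, hl⟩
    | succ k =>
      have := ih hl (by simpa using hk)
      exact ⟨⟨hd, this.1⟩, this.2⟩

lemma wordDeg_append (u v : List (DArrow I)) : wordDeg (u ++ v) = wordDeg u + wordDeg v :=
  List.countP_append

variable [Fintype I]

/-- The skew-symmetric part of `Φ`, applied entrywise. -/
noncomputable def skewPhi (α : I → ℕ) :
    PathAlg I →ₗ[ℂ] Matrix (BlockIdx α) (BlockIdx α) (PolyvectorField (RepCoord α)) :=
  (skew (RepCoord α)).toLinearMap.mapMatrix ∘ₗ Phi α

lemma skewPhi_apply (α : I → ℕ) (Z : PathAlg I) (x y : BlockIdx α) :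
    skewPhi α Z x y = skew _ (Phi α Z x y) := rfl

lemma skewPhi_single (α : I → ℕ) (p : DPath I) (x y : BlockIdx α) :
    skewPhi α (Finsupp.single p 1) x y = skew _ (evalWord α p.tgt p.word x y) := by
  simp [skewPhi_apply, Phi]

lemma skewPhi_ofWord (α : I → ℕ) {j i : I} {u : List (DArrow I)} (h : IsPath j u i)
    (x y : BlockIdx α) :
    skewPhi α (ofWord j u i) x y = skew _ (evalWord α j u x y) := by
  rw [ofWord, dif_pos h, skewPhi_single]

lemma PsiPath_eq (lam : I → ℂ) (α : I → ℕ) (Z : PathAlg I) :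
    PsiPath lam α Z = ∑ x : BlockIdx α, lam x.1 • skewPhi α Z x x := by
  simp [PsiPath, traceLam, skewPhi_apply]

lemma skewPhi_mulPath (α : I → ℕ) (p q : DPath I) :
    skewPhi α (mulPath p q) =
      skewPhi α (Finsupp.single p 1) * skewPhi α (Finsupp.single q 1) := by
  ext x y
  rw [Matrix.mul_apply]
  simp only [skewPhi_single]
  by_cases h : p.src = q.tgt
  · rw [mulPath_of_eq p q h, skewPhi_single]
    simp only [evalWord_append α p.isPath, h, Matrix.mul_apply, map_sum, map_mul]
  · rw [mulPath, if_neg h, map_zero, Matrix.zero_apply]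
    refine (Finset.sum_eq_zero fun z _ => ?_).symm
    -- For paths that do not compose, an intermediate index `z` cannot lie both in the column block
    -- of `p` and in the row block of `q`.
    by_cases hz : z.1 = p.src
    · rw [evalWord_apply_left α q.tgt q.word z y (hz ▸ h), map_zero, mul_zero]
    · rw [evalWord_apply_right α p.isPath x z hz, map_zero, zero_mul]

lemma skewPhi_pmul (α : I → ℕ) (A B : PathAlg I) :
    skewPhi α (pmul A B) = skewPhi α A * skewPhi α B := by
  induction A using Finsupp.induction_linear with
  | zero => simp
  | add A A' h h' => simp only [map_add, LinearMap.add_apply, h, h', add_mul]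
  | single p c =>
    induction B using Finsupp.induction_linear with
    | zero => simp
    | add A A' h h' => simp only [map_add, h, h', mul_add]
    | single q d =>
      rw [← mul_one c, ← mul_one d, ← smul_eq_mul, ← smul_eq_mul, ← Finsupp.smul_single,
        ← Finsupp.smul_single]
      simp only [map_smul, LinearMap.smul_apply, pmul_single, skewPhi_mulPath]
      rw [Matrix.smul_mul, Matrix.mul_smul, smul_comm]

end Words

/-! ### Differentiating the entries of the matrix of a path -/

section Entries

variable {I : Type*} [Quiver I]

/-- The coordinate function or coordinate vector field which is the entry of `tilde α d` with
the given row and column. -/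
noncomputable def tildeEntry (α : I → ℕ) :
    (d : DArrow I) → Fin (α d.head) → Fin (α d.tail) → TensorField (RepCoord α)
  | Sum.inl a, m, n => coordFun ⟨a, m, n⟩
  | Sum.inr a, n, m => coordVec ⟨a, m, n⟩

/-- The operation dual to `tildeEntry`: the derivative of the coefficients for an arrow, the
contraction for a dual arrow. -/
noncomputable def fieldDeriv (α : I → ℕ) : (w : DArrow I) → Fin (α w.head) → Fin (α w.tail) →
    (PolyvectorField (RepCoord α) →ₗ[ℂ] PolyvectorField (RepCoord α))
  | Sum.inl a, m, n => coeffDeriv ⟨a, m, n⟩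
  | Sum.inr a, n, m => contract ⟨a, m, n⟩

/-- One signed rule covers both kinds of arrow: the exponent contains the degree of `w`, so
coefficient derivatives get no sign and contractions get the sign of `contract_mul`. -/
lemma fieldDeriv_mul (α : I → ℕ) (w : DArrow I) (p : Fin (α w.head)) (q : Fin (α w.tail))
    (x : PolyvectorField (RepCoord α)) {s : ℕ} {y : PolyvectorField (RepCoord α)}
    (hy : y ∈ polyGrade _ s) :
    fieldDeriv α w p q (x * y) = x * fieldDeriv α w p q y +
      (-1 : ℂ) ^ (wordDeg [w] * s) • (fieldDeriv α w p q x * y) := by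
  rcases w with a | a
  · simpa [fieldDeriv, wordDeg] using coeffDeriv_mul _ x y
  · simpa [fieldDeriv, wordDeg] using contract_mul _ x hy

open Classical in
lemma fieldDeriv_tildeEntry (α : I → ℕ) (w : DArrow I) (p p' : Fin (α w.head))
    (q q' : Fin (α w.tail)) :
    fieldDeriv α w p q (skew _ (tildeEntry α w p' q')) = if p' = p ∧ q' = q then 1 else 0 := by
  rcases w with a | a
  · simp only [fieldDeriv, tildeEntry, coordFun, skew, Algebra.TensorProduct.map_tmul, map_one,
      AlgHom.id_apply, coeffDeriv_tmul, MvPolynomial.pderiv_X, Pi.single_apply]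
    by_cases h : p' = p ∧ q' = q
    · obtain ⟨rfl, rfl⟩ := h
      simp [Algebra.TensorProduct.one_def]
    · rw [if_neg h, if_neg, TensorProduct.zero_tmul]
      rintro h'
      have := eq_of_heq (Sigma.mk.inj h').2
      exact h ⟨congrArg Prod.fst this, congrArg Prod.snd this⟩
  · simp only [fieldDeriv, tildeEntry, coordVec, skew, Algebra.TensorProduct.map_tmul, map_one,
      contract_tmul, TensorAlgebra.toExterior_ι]
    rw [ExteriorAlgebra.ι, CliffordAlgebra.contractRight_ι, Finsupp.lapply_apply,
      Finsupp.single_apply]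
    by_cases h : p' = p ∧ q' = q
    · obtain ⟨rfl, rfl⟩ := h
      simp [Algebra.TensorProduct.one_def]
    · rw [if_neg h, if_neg, map_zero, TensorProduct.tmul_zero]
      rintro h'
      have := eq_of_heq (Sigma.mk.inj h').2
      exact h ⟨congrArg Prod.snd this, congrArg Prod.fst this⟩

lemma fieldDeriv_tildeEntry_of_ne (α : I → ℕ) (w d : DArrow I) (h : d ≠ w)
    (p : Fin (α w.head)) (q : Fin (α w.tail)) (p' : Fin (α d.head)) (q' : Fin (α d.tail)) :
    fieldDeriv α w p q (skew _ (tildeEntry α d p' q')) = 0 := by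
  classical
  rcases w with a | a <;> rcases d with b | b <;>
    simp only [fieldDeriv, tildeEntry, coordFun, coordVec, skew, Algebra.TensorProduct.map_tmul,
      map_one, AlgHom.id_apply, coeffDeriv_tmul, contract_tmul, MvPolynomial.pderiv_X,
      Pi.single_apply, TensorAlgebra.toExterior_ι, Derivation.map_one_eq_zero,
      TensorProduct.zero_tmul]
  · rw [if_neg, TensorProduct.zero_tmul]
    rintro h'
    exact h (congrArg Sum.inl (congrArg Sigma.fst h'))
  · rw [← map_one (algebraMap ℂ (ExteriorAlgebra ℂ (RepCoord α →₀ ℂ))),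
      CliffordAlgebra.contractRight_algebraMap, TensorProduct.tmul_zero]
  · rw [ExteriorAlgebra.ι, CliffordAlgebra.contractRight_ι, Finsupp.lapply_apply,
      Finsupp.single_apply, if_neg, map_zero, TensorProduct.tmul_zero]
    rintro h'
    exact h (congrArg Sum.inr (congrArg Sigma.fst h'))

lemma tilde_apply (α : I → ℕ) (d : DArrow I) (p : Fin (α d.head)) (q : Fin (α d.tail)) :
    tilde α d ⟨d.head, p⟩ ⟨d.tail, q⟩ = tildeEntry α d p q := by
  classical
  rcases d with a | a
  · change Fin (α a.right) at p
    change Fin (α a.left) at q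
    simp only [tilde, Matrix.sum_apply, Matrix.single_apply]
    rw [Finset.sum_eq_single p, Finset.sum_eq_single q, if_pos ⟨rfl, rfl⟩]
    · rfl
    · rintro n - hn
      rw [if_neg]
      rintro ⟨-, h⟩
      exact hn (eq_of_heq (Sigma.mk.inj h).2)
    · simp
    · rintro m - hm
      refine Finset.sum_eq_zero fun n _ => if_neg ?_
      rintro ⟨h, -⟩
      exact hm (eq_of_heq (Sigma.mk.inj h).2)
    · simp
  · change Fin (α a.left) at p
    change Fin (α a.right) at q
    simp only [tilde, Matrix.sum_apply, Matrix.single_apply]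
    rw [Finset.sum_eq_single q, Finset.sum_eq_single p, if_pos ⟨rfl, rfl⟩]
    · rfl
    · rintro n - hn
      rw [if_neg]
      rintro ⟨h, -⟩
      exact hn (eq_of_heq (Sigma.mk.inj h).2)
    · simp
    · rintro m - hm
      refine Finset.sum_eq_zero fun n _ => if_neg ?_
      rintro ⟨-, h⟩
      exact hm (eq_of_heq (Sigma.mk.inj h).2)
    · simp

variable [Fintype I]

lemma tilde_apply_left (α : I → ℕ) (d : DArrow I) (x y : BlockIdx α) (h : x.1 ≠ d.head) :
    tilde α d x y = 0 := by
  classical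
  rw [← blockId_mul_tilde, blockId, Matrix.diagonal_mul, if_neg h, zero_mul]

lemma tilde_apply_right (α : I → ℕ) (d : DArrow I) (x y : BlockIdx α) (h : y.1 ≠ d.tail) :
    tilde α d x y = 0 := by
  classical
  rw [← tilde_mul_blockId, blockId, Matrix.mul_diagonal, if_neg h, mul_zero]

-- Coordinates and constant vector fields are dual under `fieldDeriv`: it detects one entry of the
-- matrix of `w` and annihilates every other entry and every other arrow.
open Classical in
lemma fieldDeriv_tilde (α : I → ℕ) (w d : DArrow I)
    (p : Fin (α w.head)) (q : Fin (α w.tail)) (x y : BlockIdx α) :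
    fieldDeriv α w p q (skew _ (tilde α d x y)) =
      if d = w ∧ x = ⟨w.head, p⟩ ∧ y = ⟨w.tail, q⟩ then 1 else 0 := by
  by_cases hx : x.1 = d.head
  swap
  · rw [tilde_apply_left α d x y hx, map_zero, map_zero, if_neg]
    rintro ⟨rfl, rfl, rfl⟩
    exact hx rfl
  by_cases hy : y.1 = d.tail
  swap
  · rw [tilde_apply_right α d x y hy, map_zero, map_zero, if_neg]
    rintro ⟨rfl, rfl, rfl⟩
    exact hy rfl
  obtain ⟨i, p'⟩ := x
  obtain ⟨j, q'⟩ := y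
  obtain rfl : i = d.head := hx
  obtain rfl : j = d.tail := hy
  rw [tilde_apply]
  by_cases hd : d = w
  · subst hd
    rw [fieldDeriv_tildeEntry]
    congr 1
    simp
  · rw [fieldDeriv_tildeEntry_of_ne α w d hd, if_neg (fun h => hd h.1)]

open Classical in
/-- The signed Leibniz rule along a word. -/
lemma fieldDeriv_evalWord (α : I → ℕ) (w : DArrow I) (p : Fin (α w.head)) (q : Fin (α w.tail))
    {j i : I} {l : List (DArrow I)} (hl : IsPath j l i) (x y : BlockIdx α) :
    fieldDeriv α w p q (skew _ (evalWord α j l x y)) =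
      ∑ k ∈ Finset.range l.length,
        if l[k]? = some w then
          (-1 : ℂ) ^ (wordDeg [w] * wordDeg (l.drop (k + 1))) •
            (skew _ (evalWord α j (l.take k) x ⟨w.head, p⟩) *
              skew _ (evalWord α w.tail (l.drop (k + 1)) ⟨w.tail, q⟩ y))
        else 0 := by
  induction l generalizing j x with
  | nil =>
    -- The Leibniz rule for `1 * 1` equates this value with its double.
    have h1 : fieldDeriv α w p q (1 : PolyvectorField (RepCoord α)) = 0 := by
      have := fieldDeriv_mul α w p q 1 one_mem_polyGrade
      simpa using this
    simp only [evalWord, blockId, List.map_nil, List.prod_nil, mul_one, Matrix.diagonal_apply]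
    split_ifs <;> simp [h1]
  | cons d l ih =>
    obtain ⟨rfl, hl⟩ := hl
    rw [evalWord_cons, Matrix.mul_apply, map_sum, map_sum, List.length_cons,
      Finset.sum_range_succ']
    simp only [map_mul, fieldDeriv_mul α w p q _ (skew_evalWord α hl _ y), Finset.sum_add_distrib]
    -- The shifted sum collects the occurrences of `w` after the first letter; the split-off term `k
    -- = 0` is the leading letter `d`.
    congr 1
    · simp only [ih hl, Finset.mul_sum]
      rw [Finset.sum_comm]
      refine Finset.sum_congr rfl fun k _ => ?_
      simp only [List.getElem?_cons_succ, List.drop_succ_cons, List.take_succ_cons]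
      split_ifs with h
      · rw [evalWord_cons, Matrix.mul_apply, map_sum, Finset.sum_mul, Finset.smul_sum]
        refine Finset.sum_congr rfl fun z _ => ?_
        rw [map_mul, mul_smul_comm, mul_assoc]
      · simp
    · simp only [fieldDeriv_tilde, List.getElem?_cons_zero, Option.some.injEq, List.drop_succ_cons,
        List.drop_zero, List.take_zero]
      by_cases h : d = w
      · subst h
        rw [if_pos rfl, Finset.sum_eq_single ⟨d.tail, q⟩]
        · have e : evalWord α d.head [] x ⟨d.head, p⟩ = if x = ⟨d.head, p⟩ then 1 else 0 := by
            simp only [evalWord, blockId, List.map_nil, List.prod_nil, mul_one,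
              Matrix.diagonal_apply]
            by_cases hx : x = ⟨d.head, p⟩
            · subst hx; simp
            · simp [hx]
          rw [e]
          by_cases hx : x = ⟨d.head, p⟩ <;> simp [hx]
        · rintro z - hz
          rw [if_neg (fun h => hz h.2.2)]
          simp
        · simp
      · simp [h]

end Entries

lemma sum_blockIdx_eq {I : Type*} [Fintype I] {M : Type*} [AddCommMonoid M] (α : I → ℕ) (i : I) (f : BlockIdx α → M)
    (hf : ∀ x : BlockIdx α, x.1 ≠ i → f x = 0) : ∑ x, f x = ∑ m : Fin (α i), f ⟨i, m⟩ := by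
  classical
  rw [Fintype.sum_sigma, Finset.sum_eq_single i]
  · exact fun j _ hj => Finset.sum_eq_zero fun m _ => hf _ hj
  · simp

/-! ### Compatibility of `Ψ` with the Schouten brackets -/

section Bracket

variable {I : Type*} [Quiver I] [Fintype I]

/-- The Leibniz rule on the trace of `u w v` leaves a sum of products of an entry of `u` and an
entry of `v`. Supercommuting the two factors turns it into an entry of the matrix of `v u`, and the
signs combine to the one in `wordDeriv`. The weight is constant along `u`, so it can be moved to the
head of `w`. -/
lemma fieldDeriv_PsiPath (lam : I → ℂ) (hlam : ∀ a : Quiver.Total I, lam a.right = lam a.left)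
    (α : I → ℕ) (w : DArrow I) (p : Fin (α w.head)) (q : Fin (α w.tail)) (Z : PathAlg I) :
    fieldDeriv α w p q (PsiPath lam α Z) =
      lam w.head • skewPhi α (pathDeriv w Z) ⟨w.tail, q⟩ ⟨w.head, p⟩ := by
  classical
  induction Z using Finsupp.induction_linear with
  | zero => simp
  | add A B hA hB => simp only [map_add, hA, hB, Matrix.add_apply, smul_add]
  | single u c =>
    rw [← mul_one c, ← smul_eq_mul, ← Finsupp.smul_single, map_smul, map_smul, map_smul, map_smul,
      Matrix.smul_apply, smul_comm _ c]
    congr 1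
    by_cases hu : u.tgt = u.src
    swap
    · rw [PsiPath_of_ne lam α u hu]
      simp [pathDeriv, hu]
    obtain ⟨j, l, i, hl⟩ := u
    obtain rfl : j = i := hu
    have hD : pathDeriv w (Finsupp.single ⟨j, l, j, hl⟩ 1) = wordDeriv w l := by
      simp [pathDeriv]
    rw [hD, PsiPath_single, map_sum, wordDeriv, map_sum, Matrix.sum_apply, Finset.smul_sum]
    simp only [map_smul, fieldDeriv_evalWord α w p q hl, Finset.smul_sum]
    rw [Finset.sum_comm]
    refine Finset.sum_congr rfl fun k _ => ?_
    split_ifs with hk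
    · obtain ⟨h1, h2⟩ := hl.split hk
      rw [map_smul, Matrix.smul_apply, skewPhi_ofWord α (isPath_append h2 h1),
        evalWord_append α h2, Matrix.mul_apply, map_sum, Finset.smul_sum, Finset.smul_sum]
      refine Finset.sum_congr rfl fun z _ => ?_
      -- The Leibniz sign involves the degree of `w` and the swap sign that of the letters before
      -- it; together they give the degree of the first `k + 1` letters used in `wordDeriv`.
      have hw : wordDeg (l.take (k + 1)) = wordDeg (l.take k) + wordDeg [w] := by
        rw [List.take_add_one, hk, wordDeg_append]; rfl
      rw [smul_comm, ← smul_mul_assoc, ← map_smul, evalWord_lam lam hlam α h1,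
        map_smul, smul_mul_assoc, map_mul,
        polyGrade_comm (skew_evalWord α h1 z _) (skew_evalWord α h2 _ z), smul_comm _ (lam w.head),
        smul_smul (_ ^ _) (_ ^ _), ← pow_add, hw]
      congr 3
      ring
    · simp

lemma skewPhi_pathDeriv_apply_left (α : I → ℕ) (w : DArrow I) (Z : PathAlg I) (x y : BlockIdx α)
    (h : x.1 ≠ w.tail) : skewPhi α (pathDeriv w Z) x y = 0 := by
  classical
  induction Z using Finsupp.induction_linear with
  | zero => simp
  | add A B hA hB => simp only [map_add, hA, hB, Matrix.add_apply, add_zero]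
  | single u c =>
    rw [pathDeriv, Finsupp.linearCombination_single, map_smul, Matrix.smul_apply]
    split_ifs
    · rw [wordDeriv, map_sum, Matrix.sum_apply, Finset.sum_eq_zero, smul_zero]
      intro k _
      split_ifs
      · rw [map_smul, Matrix.smul_apply, ofWord]
        split_ifs
        · rw [skewPhi_single, evalWord_apply_left _ _ _ _ _ h, map_zero, smul_zero]
        · simp
      · simp
    · simp

lemma skewPhi_pathDeriv_apply_right (α : I → ℕ) (w : DArrow I) (Z : PathAlg I)
    (x y : BlockIdx α) (h : y.1 ≠ w.head) : skewPhi α (pathDeriv w Z) x y = 0 := by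
  classical
  induction Z using Finsupp.induction_linear with
  | zero => simp
  | add A B hA hB => simp only [map_add, hA, hB, Matrix.add_apply, add_zero]
  | single u c =>
    rw [pathDeriv, Finsupp.linearCombination_single, map_smul, Matrix.smul_apply]
    split_ifs
    · rw [wordDeriv, map_sum, Matrix.sum_apply, Finset.sum_eq_zero, smul_zero]
      intro k _
      split_ifs
      · rw [map_smul, Matrix.smul_apply, ofWord]
        split_ifs with h'
        · rw [skewPhi_single, evalWord_apply_right _ h' _ _ h, map_zero, smul_zero]
        · simp
      · simp
    · simp

/-- The contribution of an arrow to the Schouten bracket of the images under `Ψ`. -/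
lemma sum_contract_mul_coeffDeriv (lam : I → ℂ)
    (hlam : ∀ a : Quiver.Total I, lam a.right = lam a.left) (α : I → ℕ) (a : Quiver.Total I)
    (A B : PathAlg I) :
    ∑ mn : Fin (α a.right) × Fin (α a.left),
      contract (⟨a, mn⟩ : RepCoord α) (PsiPath lam α A) *
        coeffDeriv (⟨a, mn⟩ : RepCoord α) (PsiPath lam α B) =
      PsiPath (fun i => lam i ^ 2) α
        (pmul (pathDeriv (Sum.inr a) A) (pathDeriv (Sum.inl a) B)) := by
  -- The superderivative along `a*` sits in the block `(h a, t a)` and the one along `a` in `(t a, h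
  -- a)`, so only the block `h a` contributes to the trace.
  rw [PsiPath_eq (fun i => lam i ^ 2), skewPhi_pmul, sum_blockIdx_eq α a.right, Fintype.sum_prod_type]
  · refine Finset.sum_congr rfl fun m _ => ?_
    rw [Matrix.mul_apply, sum_blockIdx_eq α a.left, Finset.smul_sum]
    · refine Finset.sum_congr rfl fun n _ => ?_
      have h1 := fieldDeriv_PsiPath lam hlam α (Sum.inr a) n m A
      have h2 := fieldDeriv_PsiPath lam hlam α (Sum.inl a) m n B
      simp only [fieldDeriv, DArrow.head, DArrow.tail] at h1 h2
      -- The weights at the heads of `a*` and `a`, namely at `t a` and `h a`, agree; this produces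
      -- the square.
      rw [h1, h2, smul_mul_smul_comm, ← hlam, sq]
    · intro x hx
      rw [skewPhi_pathDeriv_apply_right _ _ _ _ _ hx, zero_mul]
  · intro x hx
    rw [Matrix.mul_apply, Finset.sum_eq_zero, smul_zero]
    intro y _
    rw [skewPhi_pathDeriv_apply_left _ _ _ _ _ hx, zero_mul]

/-- The map `Ψ` intertwines the Schouten brackets, up to squaring the weights of the trace. -/
lemma polySchouten_Psi [Fintype (Quiver.Total I)] (lam : I → ℂ)
    (hlam : ∀ a : Quiver.Total I, lam a.right = lam a.left)
    (hlam2 : ∀ a : Quiver.Total I, lam a.right ^ 2 = lam a.left ^ 2) (α : I → ℕ) {r s : ℕ}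
    (γ : necklaceGrade I r) (δ : necklaceGrade I s) :
    polySchouten (Psi lam hlam α γ) (Psi lam hlam α δ) =
      PsiNecklace (fun i => lam i ^ 2) hlam2 α (schouten γ δ) := by
  obtain ⟨_, A, hA, rfl⟩ := γ
  obtain ⟨_, B, hB, rfl⟩ := δ
  change ∑ l : RepCoord α, (contract l (PsiPath lam α A) * coeffDeriv l (PsiPath lam α B) -
    (-1 : ℂ) ^ ((r + 1) * (s + 1)) •
      (contract l (PsiPath lam α B) * coeffDeriv l (PsiPath lam α A))) =
    PsiPath (fun i => lam i ^ 2) α (∑ a : Quiver.Total I,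
      (pmul (pathDeriv (Sum.inr a) A) (pathDeriv (Sum.inl a) B) -
        (-1 : ℂ) ^ ((r + 1) * (s + 1)) •
          pmul (pathDeriv (Sum.inr a) B) (pathDeriv (Sum.inl a) A)))
  rw [map_sum, Fintype.sum_sigma]
  refine Finset.sum_congr rfl fun a _ => ?_
  rw [Finset.sum_sub_distrib, ← Finset.smul_sum, sum_contract_mul_coeffDeriv lam hlam,
    sum_contract_mul_coeffDeriv lam hlam, map_sub, map_smul]

end Bracket

/-! ### Recovering a necklace from its superderivatives -/

section Euler

variable {I : Type*} [Quiver I]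

open Classical in
/-- Append the arrow `w` to a path, pass to necklaces, and divide by the length. -/
noncomputable def appendArrow (w : DArrow I) : PathAlg I →ₗ[ℂ] Necklace I :=
  Finsupp.linearCombination ℂ fun p : DPath I =>
    ((p.word.length : ℂ) + 1)⁻¹ • (superComm I).mkQ (ofWord p.tgt (p.word ++ [w]) w.tail)

lemma mkQ_mulPath (p q : DPath I) :
    (superComm I).mkQ (mulPath p q) =
      (-1 : ℂ) ^ (p.deg * q.deg) • (superComm I).mkQ (mulPath q p) := by
  rw [← map_smul, ← sub_eq_zero, ← map_sub, Submodule.mkQ_apply, Submodule.Quotient.mk_eq_zero]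
  refine Submodule.subset_span ⟨p.deg, q.deg, Finsupp.single p 1, Finsupp.single q 1,
    Submodule.subset_span ⟨p, rfl, rfl⟩, Submodule.subset_span ⟨q, rfl, rfl⟩, ?_⟩
  rw [pmul_single, pmul_single]

/-- Multiplying by the trivial path at the source fixes `p` on one side and kills it on the other,
while the two products agree in the quotient. -/
lemma mkQ_single_of_ne (p : DPath I) (h : p.tgt ≠ p.src) :
    (superComm I).mkQ (Finsupp.single p 1) = 0 := by
  have := mkQ_mulPath p ⟨p.src, [], p.src, rfl⟩
  rw [mulPath_of_eq _ _ rfl, mulPath, if_neg (Ne.symm h), map_zero, smul_zero] at this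
  simpa using this

lemma ofWord_eq_single {j i : I} {l : List (DArrow I)} (h : IsPath j l i) :
    ofWord j l i = Finsupp.single ⟨j, l, i, h⟩ 1 := dif_pos h

lemma mkQ_ofWord_rotate {j i : I} {u v : List (DArrow I)} (hu : IsPath j u i)
    (hv : IsPath i v j) :
    (superComm I).mkQ (ofWord j (u ++ v) j) =
      (-1 : ℂ) ^ (wordDeg u * wordDeg v) • (superComm I).mkQ (ofWord i (v ++ u) i) := by
  have := mkQ_mulPath ⟨j, u, i, hu⟩ ⟨i, v, j, hv⟩
  rw [mulPath_of_eq _ _ rfl, mulPath_of_eq _ _ rfl] at this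
  rw [ofWord_eq_single (isPath_append hu hv), ofWord_eq_single (isPath_append hv hu)]
  exact this

/-- The span of the nontrivial paths in the path algebra. -/
noncomputable def nontrivialPaths (I : Type*) [Quiver I] : Submodule ℂ (PathAlg I) :=
  Submodule.span ℂ {x | ∃ p : DPath I, p.word ≠ [] ∧ x = Finsupp.single p 1}

/-- Euler's formula: a necklace without trivial paths is determined by its superderivatives. -/
lemma sum_appendArrow_superDeriv [Fintype (Quiver.Total I)] {Z : PathAlg I}
    (hZ : Z ∈ nontrivialPaths I) :
    ∑ w : DArrow I, appendArrow w (pathDeriv w Z) = (superComm I).mkQ Z := by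
  classical
  induction hZ using Submodule.span_induction with
  | zero => simp
  | add A B _ _ hA hB => simp only [map_add, Finset.sum_add_distrib, hA, hB]
  | smul c A _ hA => simp only [map_smul, ← Finset.smul_sum, hA]
  | mem A hA =>
    obtain ⟨p, hp, rfl⟩ := hA
    by_cases h : p.tgt = p.src
    swap
    · rw [mkQ_single_of_ne p h]
      simp [pathDeriv, h]
    obtain ⟨j, l, i, hl⟩ := p
    obtain rfl : j = i := h
    simp only [pathDeriv, Finsupp.linearCombination_single, one_smul, if_true, wordDeriv, map_sum]
    rw [Finset.sum_comm]
    have key : ∀ k ∈ Finset.range l.length, (∑ w : DArrow I, appendArrow w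
        (if l[k]? = some w then
          (-1 : ℂ) ^ (wordDeg (l.drop (k + 1)) * wordDeg (l.take (k + 1))) •
            ofWord w.tail (l.drop (k + 1) ++ l.take k) w.head else 0)) =
        (l.length : ℂ)⁻¹ • (superComm I).mkQ (Finsupp.single ⟨j, l, j, hl⟩ 1) := by
      intro k hk
      rw [Finset.mem_range] at hk
      have hk' : l[k]? = some l[k] := List.getElem?_eq_getElem hk
      rw [Finset.sum_eq_single l[k], if_pos hk']
      · obtain ⟨h1, h2⟩ := hl.split hk'
        generalize hw : l[k] = w at *
        have h3 : IsPath w.head [w] w.tail := ⟨rfl, rfl⟩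
        have h4 : l.take (k + 1) = l.take k ++ [w] := by
          rw [List.take_add_one, hk']; rfl
        have h5 := isPath_append h1 h3
        rw [← h4] at h5
        -- The superderivative has removed one letter, so the `+ 1` in `appendArrow` restores the
        -- original length.
        have h6 : (((l.drop (k + 1) ++ l.take k).length : ℂ) + 1) = l.length := by
          have : (l.drop (k + 1) ++ l.take k).length + 1 = l.length := by
            simp; omega
          exact_mod_cast this
        rw [map_smul, ofWord_eq_single (isPath_append h2 h1), appendArrow,
          Finsupp.linearCombination_single, one_smul, smul_comm]
        simp only [h6, List.append_assoc, ← h4]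
        -- Putting `w` back yields a rotation of `l`; the sign of that rotation is exactly the sign
        -- in `wordDeriv`.
        rw [← mul_comm (wordDeg (l.take (k + 1))), ← mkQ_ofWord_rotate h5 h2,
          List.take_append_drop, ofWord_eq_single hl]
      · intro w _ hw
        rw [if_neg, map_zero]
        rw [hk']
        exact fun h => hw (Option.some.inj h).symm
      · simp
    -- Each of the `l.length` positions contributes the same multiple of the class; nontriviality of
    -- the path allows the length to cancel.
    rw [Finset.sum_congr rfl key, Finset.sum_const, Finset.card_range, ← Nat.cast_smul_eq_nsmul ℂ,
      smul_smul, mul_inv_cancel₀, one_smul]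
    simpa using hp

end Euler

/-! ### Separating paths by specialized matrices -/

section Detection

variable {I : Type*} [Quiver I]

/-- The value at which the `k`-th arrow of a word is detected: `1` for an arrow, the `k`-th
generator of the exterior algebra for a dual arrow. -/
noncomputable def arrowValue (k : ℕ) : DArrow I → ExteriorAlgebra ℂ (ℕ →₀ ℂ)
  | Sum.inl _ => 1
  | Sum.inr _ => ExteriorAlgebra.ι ℂ (Finsupp.single k 1)

/-- The product of the values of the arrows of a word whose first arrow has number `k`. -/
noncomputable def wordValue : ℕ → List (DArrow I) → ExteriorAlgebra ℂ (ℕ →₀ ℂ)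
  | _, [] => 1
  | k, d :: u => arrowValue k d * wordValue (k + 1) u

lemma contractLeft_wordValue {k' k : ℕ} (h : k' < k) (u : List (DArrow I)) :
    CliffordAlgebra.contractLeft (Finsupp.lapply k' : Module.Dual ℂ (ℕ →₀ ℂ))
      (wordValue k u) = 0 := by
  induction u generalizing k with
  | nil => exact CliffordAlgebra.contractLeft_one _ _
  | cons d u ih =>
    rcases d with a | a
    · rw [wordValue, arrowValue, one_mul, ih (by omega)]
    · rw [wordValue, arrowValue, ExteriorAlgebra.ι, CliffordAlgebra.contractLeft_ι_mul,
        ih (by omega), Finsupp.lapply_apply, Finsupp.single_eq_of_ne h.ne, zero_smul, mul_zero,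
        sub_zero]

/-- Distinct positions use distinct generators, so no product of them collapses. Contracting with
the `k`-th coordinate strips a leading generator and, by `contractLeft_wordValue`, does not touch
the later ones. -/
lemma wordValue_ne_zero (k : ℕ) (u : List (DArrow I)) : wordValue k u ≠ 0 := by
  induction u generalizing k with
  | nil => exact one_ne_zero
  | cons d u ih =>
    rcases d with a | a
    · rw [wordValue, arrowValue, one_mul]; exact ih _
    · intro h
      have := congrArg (CliffordAlgebra.contractLeft
        (Finsupp.lapply k : Module.Dual ℂ (ℕ →₀ ℂ))) h
      rw [wordValue, arrowValue, ExteriorAlgebra.ι, CliffordAlgebra.contractLeft_ι_mul,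
        contractLeft_wordValue (Nat.lt_succ_self k), Finsupp.lapply_apply,
        Finsupp.single_eq_same, one_smul, mul_zero, sub_zero, map_zero] at this
      exact ih _ this

open Classical in
/-- The specialization of the coordinates and vector fields on `Rep(Q, α)`, for a constant `α`,
under which `tilde α d` has an entry in row `k` only if `d` is the `k`-th arrow of `l`, and then
only in column `k + 1`. -/
noncomputable def specialize (N : ℕ) (l : List (DArrow I)) :
    PolyvectorField (RepCoord fun _ : I => N) →ₐ[ℂ] ExteriorAlgebra ℂ (ℕ →₀ ℂ) :=
  Algebra.TensorProduct.lift
    ((Algebra.ofId ℂ _).comp (MvPolynomial.aeval fun c : RepCoord fun _ : I => N =>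
      if (c.2.2 : ℕ) = c.2.1 + 1 ∧ l[(c.2.1 : ℕ)]? = some (Sum.inl c.1) then (1 : ℂ) else 0))
    (ExteriorAlgebra.map (Finsupp.linearCombination ℂ fun c : RepCoord fun _ : I => N =>
      if (c.2.1 : ℕ) = c.2.2 + 1 ∧ l[(c.2.2 : ℕ)]? = some (Sum.inr c.1)
        then Finsupp.single (c.2.2 : ℕ) (1 : ℂ) else 0))
    -- The polynomial coefficients specialize to scalars, which are central.
    (fun f _ => Algebra.commutes (MvPolynomial.aeval _ f : ℂ) _)

open Classical in
lemma specialize_tildeEntry (N : ℕ) (l : List (DArrow I)) (d : DArrow I) (p q : Fin N) :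
    specialize N l (skew _ (tildeEntry (fun _ => N) d p q)) =
      if (q : ℕ) = p + 1 ∧ l[(p : ℕ)]? = some d then arrowValue p d else 0 := by
  rcases d with a | a
  · simp only [tildeEntry, coordFun, skew, Algebra.TensorProduct.map_tmul, map_one,
      AlgHom.id_apply, specialize, Algebra.TensorProduct.lift_tmul, AlgHom.comp_apply,
      MvPolynomial.aeval_X, mul_one, arrowValue]
    split_ifs <;> simp
  · simp only [tildeEntry, coordVec, skew, Algebra.TensorProduct.map_tmul, map_one,
      TensorAlgebra.toExterior_ι, specialize, Algebra.TensorProduct.lift_tmul, one_mul,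
      ExteriorAlgebra.map_apply_ι, Finsupp.linearCombination_single, one_smul, arrowValue]
    split_ifs <;> simp

variable [Fintype I]

-- After specialization each letter advances the row index by exactly one and must agree with the
-- letter of `l` at that position. Going from row `k` to the last column therefore forces the word
-- to spell out the rest of `l`; size `l.length + 1` leaves exactly enough room.
open Classical in
lemma specialize_evalWord (l u : List (DArrow I)) {j i : I} (hu : IsPath j u i)
    (k : Fin (l.length + 1)) :
    specialize (l.length + 1) l
      (skew _ (evalWord (fun _ => l.length + 1) j u ⟨j, k⟩ ⟨i, Fin.last _⟩)) =
      if u = l.drop k then wordValue k u else 0 := by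
  induction u generalizing j k with
  | nil =>
    simp only [IsPath] at hu
    subst hu
    simp only [evalWord, blockId, List.map_nil, List.prod_nil, mul_one, Matrix.diagonal_apply,
      if_true]
    have : ((⟨j, k⟩ : BlockIdx fun _ : I => l.length + 1) = ⟨j, Fin.last _⟩) ↔
        [] = l.drop k := by
      rw [eq_comm (a := []), List.drop_eq_nil_iff]
      constructor
      · intro h
        have := eq_of_heq (Sigma.mk.inj h).2
        simp [this]
      · intro h
        have : k = Fin.last _ := Fin.ext (le_antisymm (Fin.is_le k) h)
        rw [this]
    rw [apply_ite (skew _), apply_ite (specialize _ _), map_one, map_one, map_zero, map_zero]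
    exact if_congr this rfl rfl
  | cons d u ih =>
    obtain ⟨rfl, hu⟩ := hu
    rw [evalWord_cons, Matrix.mul_apply, map_sum, map_sum, sum_blockIdx_eq _ d.tail]
    swap
    · intro z hz
      rw [tilde_apply_right _ _ _ _ hz, zero_mul, map_zero, map_zero]
    have e : ∀ m : Fin (l.length + 1), specialize (l.length + 1) l (skew _
        (tilde (fun _ => l.length + 1) d ⟨d.head, k⟩ ⟨d.tail, m⟩ *
          evalWord (fun _ => l.length + 1) d.tail u ⟨d.tail, m⟩ ⟨i, Fin.last _⟩)) =
        if (m : ℕ) = k + 1 ∧ d :: u = l.drop k then wordValue k (d :: u) else 0 := by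
      intro m
      rw [map_mul, map_mul, tilde_apply, specialize_tildeEntry, ih hu]
      by_cases hm : (m : ℕ) = k + 1
      swap
      · simp [hm]
      -- The index `m = k + 1` is at most `l.length`, so `l` does have a letter at position `k`.
      have hk : (k : ℕ) < l.length := by omega
      have : d :: u = l.drop k ↔ l[(k : ℕ)]? = some d ∧ u = l.drop m := by
        rw [List.drop_eq_getElem_cons hk, List.getElem?_eq_getElem hk, hm, List.cons.injEq,
          Option.some.injEq, eq_comm]
      simp only [this, hm]
      by_cases h1 : l[(k : ℕ)]? = some d <;> by_cases h2 : u = l.drop (k + 1) <;>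
        simp [h1, h2, wordValue]
    rw [Finset.sum_congr rfl fun m _ => e m]
    by_cases h : d :: u = l.drop k
    · have hk : (k : ℕ) < l.length := by
        by_contra hk
        rw [List.drop_eq_nil_of_le (by omega)] at h
        simp at h
      rw [Finset.sum_eq_single ⟨k + 1, by omega⟩]
      · simp [h]
      · rintro m - hm
        rw [if_neg]
        rintro ⟨h', -⟩
        exact hm (Fin.ext h')
      · simp
    · simp [h]

/-- An element of the path algebra is determined by its images under `Φ`, for all dimension
vectors, even after passing to skew-symmetric parts. -/
lemma eq_zero_of_skewPhi_eq_zero (Z : PathAlg I) (hZ : ∀ α : I → ℕ, skewPhi α Z = 0) :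
    Z = 0 := by
  classical
  ext p
  -- Specializing along the word of `p` makes this one corner entry read off the coefficient of `p`:
  -- the blocks fix the end points, the row and column fix the word.
  have key : ∀ Y : PathAlg I, specialize (p.word.length + 1) p.word
      (skewPhi (fun _ => p.word.length + 1) Y ⟨p.tgt, 0⟩ ⟨p.src, Fin.last _⟩) =
      Y p • wordValue 0 p.word := by
    intro Y
    induction Y using Finsupp.induction_linear with
    | zero => simp
    | add A B hA hB => simp only [map_add, Matrix.add_apply, hA, hB, Finsupp.add_apply, add_smul]
    | single u c =>
      rw [← mul_one c, ← smul_eq_mul, ← Finsupp.smul_single, map_smul, Matrix.smul_apply, map_smul,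
        skewPhi_single, Finsupp.smul_apply, smul_assoc]
      congr 1
      by_cases h1 : u.tgt = p.tgt
      swap
      · rw [evalWord_apply_left _ _ _ _ _ (Ne.symm h1), Finsupp.single_eq_of_ne, map_zero,
          map_zero, zero_smul]
        rintro rfl
        exact h1 rfl
      by_cases h2 : u.src = p.src
      swap
      · rw [evalWord_apply_right _ u.isPath _ _ (Ne.symm h2), Finsupp.single_eq_of_ne, map_zero,
          map_zero, zero_smul]
        rintro rfl
        exact h2 rfl
      rw [← h1, ← h2, specialize_evalWord p.word u.word u.isPath 0, Finsupp.single_apply]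
      by_cases h3 : u.word = p.word
      · have : u = p := DPath.ext h1 h3 h2
        simp [this]
      · rw [if_neg, if_neg, zero_smul]
        · rintro rfl
          exact h3 rfl
        · simpa using h3
  have := key Z
  rw [hZ, Matrix.zero_apply, map_zero, eq_comm, smul_eq_zero] at this
  exact this.resolve_right (wordValue_ne_zero _ _)

end Detection

/-! ### Joint injectivity of the maps `Ψ` away from trivial paths -/

section Kernel

variable {I : Type*} [Quiver I]

lemma pathDeriv_mem_nontrivialPaths {r : ℕ} (hr : 2 ≤ r) (w : DArrow I) {Z : PathAlg I}
    (hZ : Z ∈ pathGrade I r) :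
    pathDeriv w Z ∈ nontrivialPaths I := by
  classical
  refine (Submodule.span_le (p := (nontrivialPaths I).comap (pathDeriv w))).mpr ?_ hZ
  rintro _ ⟨p, hp, rfl⟩
  rw [SetLike.mem_coe, Submodule.mem_comap, pathDeriv, Finsupp.linearCombination_single, one_smul]
  -- At least two dual arrows means at least two letters, so one survives the removal of `w`.
  have hlen : 2 ≤ p.word.length := hr.trans (hp ▸ List.countP_le_length)
  split_ifs
  · refine Submodule.sum_mem _ fun k hk => ?_
    rw [Finset.mem_range] at hk
    split_ifs
    · refine Submodule.smul_mem _ _ ?_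
      rw [ofWord]
      split_ifs
      · refine Submodule.subset_span ⟨_, ?_, rfl⟩
        intro h
        have : (p.word.drop (k + 1) ++ p.word.take k).length = 0 := congrArg List.length h
        rw [List.length_append, List.length_drop, List.length_take] at this
        omega
      · exact Submodule.zero_mem _
    · exact Submodule.zero_mem _
  · exact Submodule.zero_mem _

lemma pmul_mem_nontrivialPaths {A : PathAlg I}
    (hA : A ∈ nontrivialPaths I) (B : PathAlg I) :
    pmul A B ∈ nontrivialPaths I := by
  refine (Submodule.span_le (p := (nontrivialPaths I).comap (pmul.flip B))).mpr ?_ hA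
  rintro _ ⟨p, hp, rfl⟩
  rw [SetLike.mem_coe, Submodule.mem_comap, LinearMap.flip_apply]
  induction B using Finsupp.induction_linear with
  | zero => simp
  | add B B' h h' => rw [map_add]; exact add_mem h h'
  | single q c =>
    rw [← mul_one c, ← smul_eq_mul, ← Finsupp.smul_single, map_smul, pmul_single]
    refine Submodule.smul_mem _ _ ?_
    by_cases h : p.src = q.tgt
    · rw [mulPath_of_eq p q h]
      exact Submodule.subset_span ⟨_, by simp [hp], rfl⟩
    · rw [mulPath, if_neg h]
      exact Submodule.zero_mem _

/-- The maps `Ψ` are jointly injective on necklaces without trivial paths. -/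
lemma mkQ_eq_zero_of_PsiPath_eq_zero [Fintype I] [Fintype (Quiver.Total I)] (lam : I → ℂ)
    (hlam : ∀ a : Quiver.Total I, lam a.right = lam a.left)
    (hlam0 : ∀ a : Quiver.Total I, lam a.right ≠ 0) {Z : PathAlg I}
    (hZ : Z ∈ nontrivialPaths I)
    (h : ∀ α : I → ℕ, PsiPath lam α Z = 0) : (superComm I).mkQ Z = 0 := by
  rw [← sum_appendArrow_superDeriv hZ]
  refine Finset.sum_eq_zero fun w _ => ?_
  rw [eq_zero_of_skewPhi_eq_zero (pathDeriv w Z), map_zero]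
  intro α
  ext x y
  rw [Matrix.zero_apply]
  by_cases hx : x.1 = w.tail
  swap
  · exact skewPhi_pathDeriv_apply_left α w Z x y hx
  by_cases hy : y.1 = w.head
  swap
  · exact skewPhi_pathDeriv_apply_right α w Z x y hy
  obtain ⟨i, q⟩ := x
  obtain ⟨j, p⟩ := y
  obtain rfl : i = w.tail := hx
  obtain rfl : j = w.head := hy
  have := fieldDeriv_PsiPath lam hlam α w p q Z
  -- The derivative of zero is the weight at the head of `w` times the entry in question, and that
  -- weight is nonzero.
  rw [h, map_zero, eq_comm, smul_eq_zero] at this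
  refine this.resolve_left ?_
  rcases w with a | a
  · exact hlam0 a
  · exact hlam a ▸ hlam0 a

end Kernel
end QuiverPoisson

theorem mainTheorem2 {I : Type*} [Quiver I] [Fintype I] [Fintype (Quiver.Total I)]
    (lam : I → ℂ) (hlam : ∀ a : Quiver.Total I, lam a.right = lam a.left)
    (hlam0 : ∀ a : Quiver.Total I, lam a.right ≠ 0)
    (P : QuiverPoisson.necklaceGrade I 2)
    (hP : ∀ α : I → ℕ, QuiverPoisson.IsPoissonField (QuiverPoisson.Psi lam hlam α P)) :
    QuiverPoisson.IsPoisson P := by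
  have hlam2 : ∀ a : Quiver.Total I, lam a.right ^ 2 = lam a.left ^ 2 := fun a => by rw [hlam]
  have hvanish : ∀ α, QuiverPoisson.PsiNecklace (fun i => lam i ^ 2) hlam2 α
      (QuiverPoisson.schouten P P) = 0 := fun α => by
    rw [← QuiverPoisson.polySchouten_Psi lam hlam hlam2]
    exact hP α
  obtain ⟨_, A, hA, rfl⟩ := P
  -- Injectivity is needed for the squared weights, which are again nonzero and equal at both ends
  -- of every arrow.
  refine QuiverPoisson.mkQ_eq_zero_of_PsiPath_eq_zero (fun i => lam i ^ 2) hlam2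
    (fun a => pow_ne_zero 2 (hlam0 a)) ?_ hvanish
  refine Submodule.sum_mem _ fun a _ => Submodule.sub_mem _ ?_ (Submodule.smul_mem _ _ ?_) <;>
  exact QuiverPoisson.pmul_mem_nontrivialPaths
    (QuiverPoisson.pathDeriv_mem_nontrivialPaths le_rfl _ hA) _
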